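/- A permutation $\tau$ of length $m$ occurs in a permutation $\sigma=\sigma_1\ldots\sigma_n$ (as a consecutive pattern) at position $i$ if $\sigma_i\sigma_{i+1}\ldots\sigma_{i+m-1}$ has the same relative order as $\tau$. An $l$-cluster ($l\ge 1$) of length $n$ for $\tau$ is a tuple $(\sigma,i_1,\ldots,i_l)$, where $\sigma$ is a permutation of length $n$, $\tau$ occurs in $\sigma$ at each of the positions $i_1,\ldots,i_l$, one has $i_k<i_{k+1}<i_k+m$ for $1\le k<l$, $i_1=1$, and $n=i_l+m-1$; there are no $0$-clusters. Let $c_{n,l}$ be the number of $l$-clusters of length $n$ for $\tau=2413$, and let $c_{n,l}(p,q)$ be the number of those with $\sigma_1=p$, $\sigma_2=q$. **Theorem.** For all $n,l\ge0$, $$c_{n,l}=\sum_{1<p<q-1<n}c_{n,l}(p,q).$$ The numbers $c_{n,l}(p,q)$ satisfy, for $n\ge5$, $l\ge1$ and $1\le p,q\le n$, the recurrence relation $$c_{n,l}(p,q)=\sum_{r<p<s<q}c_{n-2,l-1}(r,s-1)+\sum_{p<r<s<q}(p-1)\,c_{n-3,l-1}(r-2,s-2)+\sum_{p<r<q<s}(p-1)\,c_{n-3,l-1}(r-2,s-3),$$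 where the summation indices satisfy $1\le r,s\le n$, with the initial conditions $c_{n,0}(p,q)=0$ for all $n$, $c_{2,l}(p,q)=0$, $c_{3,l}(p,q)=0$, and $c_{4,l}(p,q)=\delta_{l,1}\delta_{p,2}\delta_{q,4}$. Consequently, if $\pi_{n,k}$ denotes the number of permutations of length $n$ with exactly $k$ occurrences of $2413$, then, as formal power series in $x$ over $\mathbb{Q}[t]$, $$\sum_{n,k\ge0}\pi_{n,k}\frac{x^n}{n!}t^k=\left(1-x-\sum_{n\ge2,\,l\ge1}\frac{c_{n,l}\,x^n(t-1)^l}{n!}\right)^{-1}.$$ -/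

import Mathlib

namespace ConsecutivePattern

open Finset

/-- The permutation `τ` of length `m` occurs in the permutation `σ` of length `n`, as a consecutive
pattern, at the (0-based) position `i`: the standardization of `σ_i σ_{i+1} … σ_{i+m-1}` is `τ`,
i.e. these entries are in the same relative order as the entries of `τ`. -/
def OccursAt {m n : ℕ} (τ : Equiv.Perm (Fin m)) (σ : Equiv.Perm (Fin n)) (i : ℕ) : Prop :=
  ∃ h : i + m ≤ n, ∀ a b : Fin m,
    σ ⟨i + a, by omega⟩ < σ ⟨i + b, by omega⟩ ↔ τ a < τ b

/-- The number of occurrences of `τ` in `σ`. -/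
noncomputable def occurrences {m n : ℕ} (τ : Equiv.Perm (Fin m)) (σ : Equiv.Perm (Fin n)) : ℕ :=
  {i : ℕ | OccursAt τ σ i}.ncard

/-- `π_{n,k}`: the number of permutations of length `n` with exactly `k` occurrences of `τ`. -/
noncomputable def occurrenceNumber {m : ℕ} (τ : Equiv.Perm (Fin m)) (n k : ℕ) : ℕ :=
  {σ : Equiv.Perm (Fin n) | occurrences τ σ = k}.ncard

/-- `(σ, i_1, …, i_l)` is an `l`-cluster for the pattern set `{τ}`: there is an occurrence of `τ`
at each marked position, marked occurrences are listed from left to right with adjacent ones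
overlapping, the first one is at the beginning of `σ` and the last one is at the end of `σ`
(in particular `l ≥ 1`). Positions are 0-based. -/
structure IsCluster {m n l : ℕ} (τ : Equiv.Perm (Fin m)) (σ : Equiv.Perm (Fin n))
    (i : Fin l → ℕ) : Prop where
  occurs : ∀ k : Fin l, OccursAt τ σ (i k)
  increasing : ∀ (k : ℕ) (h : k + 1 < l), i ⟨k, by omega⟩ < i ⟨k + 1, h⟩
  linked : ∀ (k : ℕ) (h : k + 1 < l), i ⟨k + 1, h⟩ < i ⟨k, by omega⟩ + m
  covered : ∃ h : 0 < l, i ⟨0, h⟩ = 0 ∧ n = i ⟨l - 1, by omega⟩ + m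

/-- `cl_{n,l}`: the number of `l`-clusters for `τ` whose permutation has length `n`. -/
noncomputable def clusterNumber {m : ℕ} (τ : Equiv.Perm (Fin m)) (n l : ℕ) : ℕ :=
  {c : Equiv.Perm (Fin n) × (Fin l → ℕ) | IsCluster τ c.1 c.2}.ncard

/-- `cl_{n,l}(p,q)`: the number of `l`-clusters for `τ` whose permutation `σ` has length `n`
and begins with the entries `p`, `q` (as elements of `{1, …, n}`). -/
noncomputable def refinedClusterNumber {m : ℕ} (τ : Equiv.Perm (Fin m)) (n l p q : ℕ) : ℕ :=
  {c : Equiv.Perm (Fin n) × (Fin l → ℕ) | IsCluster τ c.1 c.2 ∧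
    ∃ h : 2 ≤ n, (c.1 ⟨0, by omega⟩ : ℕ) + 1 = p ∧ (c.1 ⟨1, by omega⟩ : ℕ) + 1 = q}.ncard

/-- The pattern `2413`, with entries shifted down to `{0, 1, 2, 3}`. -/
def pattern2413 : Equiv.Perm (Fin 4) where
  toFun := ![1, 3, 0, 2]
  invFun := ![2, 0, 3, 1]
  left_inv := by decide
  right_inv := by decide

/-- The generating function `Π(x,t) = ∑_{n,k} π_{n,k} t^k x^n / n!`, a formal power series in `x`
over `ℚ[t]`. A nonempty pattern has at most `n` occurrences in a permutation of length `n`, see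
`occurrenceNumber_eq_zero`. -/
noncomputable def occurrenceSeries {m : ℕ} (τ : Equiv.Perm (Fin m)) : PowerSeries (Polynomial ℚ) :=
  PowerSeries.mk fun n => ∑ k ∈ range (n + 1),
    Polynomial.C ((occurrenceNumber τ n k : ℚ) / (n.factorial : ℚ)) * Polynomial.X ^ k

/-- The series `∑_{n ≥ 2, l ≥ 1} cl_{n,l} (t-1)^l x^n / n!`, a formal power series in `x` over
`ℚ[t]`. There are no `l`-clusters of length `n` for `l > n` and a nonempty pattern, see
`clusterNumber_eq_zero`. -/
noncomputable def clusterSeries {m : ℕ} (τ : Equiv.Perm (Fin m)) : PowerSeries (Polynomial ℚ) :=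
  PowerSeries.mk fun n => if 2 ≤ n then ∑ l ∈ Icc 1 n,
    Polynomial.C ((clusterNumber τ n l : ℚ) / (n.factorial : ℚ)) * (Polynomial.X - 1) ^ l else 0

theorem occurrenceNumber_eq_zero {m : ℕ} (hm : 0 < m) (τ : Equiv.Perm (Fin m)) {n k : ℕ}
    (hk : n < k) : occurrenceNumber τ n k = 0 := by
  have : {σ : Equiv.Perm (Fin n) | occurrences τ σ = k} = ∅ := by
    ext σ
    simp only [Set.mem_ofPred_eq, Set.mem_empty_iff_false, iff_false]
    have hle : occurrences τ σ ≤ n := by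
      have h := Set.ncard_le_ncard (s := {i : ℕ | OccursAt τ σ i}) (t := ↑(range n))
        (fun i hi => by obtain ⟨h, -⟩ := hi; simp; omega) (Finset.finite_toSet _)
      rwa [Set.ncard_coe_finset, card_range] at h
    omega
  rw [occurrenceNumber, this, Set.ncard_empty]

theorem clusterNumber_eq_zero {m : ℕ} (hm : 0 < m) (τ : Equiv.Perm (Fin m)) {n l : ℕ}
    (hl : n < l) : clusterNumber τ n l = 0 := by
  have : {c : Equiv.Perm (Fin n) × (Fin l → ℕ) | IsCluster τ c.1 c.2} = ∅ := by
    ext ⟨σ, i⟩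
    simp only [Set.mem_ofPred_eq, Set.mem_empty_iff_false, iff_false]
    intro hc
    have key : ∀ (k : ℕ) (h : k < l), k ≤ i ⟨k, h⟩ := by
      intro k
      induction k with
      | zero => intro h; omega
      | succ k ih =>
        intro h
        have h1 := ih (by omega)
        have h2 := hc.increasing k h
        omega
    obtain ⟨h, -⟩ := hc.occurs ⟨n, hl⟩
    have := key n hl
    omega
  rw [clusterNumber, this, Set.ncard_empty]

/-- The set of clusters counted by `clusterNumber` is finite. -/
theorem finite_clusters {m : ℕ} (τ : Equiv.Perm (Fin m)) (n l : ℕ) :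
    {c : Equiv.Perm (Fin n) × (Fin l → ℕ) | IsCluster τ c.1 c.2}.Finite := by
  have hfin : (Set.univ ×ˢ Set.Iic (fun _ => n) :
      Set (Equiv.Perm (Fin n) × (Fin l → ℕ))).Finite :=
    Set.finite_univ.prod (Set.finite_Iic _)
  refine hfin.subset ?_
  rintro ⟨σ, i⟩ hc
  refine ⟨Set.mem_univ _, fun k => ?_⟩
  obtain ⟨h, -⟩ : OccursAt τ σ (i k) := hc.occurs k
  show i k ≤ n
  omega

end ConsecutivePattern

/-! The recurrence comes from the second mark of a cluster. Occurrences of 2413 cannot start one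
place apart, so for l ≥ 2 the second mark is 2 or 3 places after the first
(`IsCluster.second_mark`). Deleting the entries before it and standardizing leaves an (l-1)-cluster
(`isCluster_cons`). At distance 2, the entries p, q go, and the next two, r < p < s < q, become r,
s-1. At distance 3 a third entry goes too, which takes any of the p-1 values below p; the next entry
r has p < r < q and drops by 2, while s, which the first occurrence does not involve, drops by 2 or
3 according to its side of q.

The generating function is the Goulden-Jackson cluster theorem. Writing t = 1 + (t-1) turns it into
a weighted count M of permutations with an arbitrary set of marked occurrences
(`sum_occurrenceNumber`). The proportion of permutations having all the marked occurrences is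
multiplicative over disjoint blocks of positions (`markedNumber_joinMarks`), so cutting at the first
gap that no marked occurrence straddles gives M = 1 + U M (`markedCoeff_eq_sum`). Here U counts the
pieces without inner cut: a single entry, or a cluster (`clusterNumber_eq_sum`). Hence M (1 - U) =
1. -/

namespace ConsecutivePattern

open Finset

/-! ### Prepending an entry to a permutation -/

/-- The permutation obtained from `ρ` by prepending the entry `p`, shifting the entries of `ρ` that
are at least `p` up by one. -/
def consPerm {n : ℕ} (p : Fin (n + 1)) (ρ : Equiv.Perm (Fin n)) : Equiv.Perm (Fin (n + 1)) :=
  (finSuccEquiv' 0).trans ((Equiv.optionCongr ρ).trans (finSuccEquiv' p).symm)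

@[simp] theorem consPerm_zero {n : ℕ} (p : Fin (n + 1)) (ρ : Equiv.Perm (Fin n)) :
    consPerm p ρ 0 = p := by
  simp [consPerm]

@[simp] theorem consPerm_succ {n : ℕ} (p : Fin (n + 1)) (ρ : Equiv.Perm (Fin n)) (j : Fin n) :
    consPerm p ρ j.succ = p.succAbove (ρ j) := by
  have : finSuccEquiv' (0 : Fin (n + 1)) j.succ = some j := by
    rw [← Fin.succAbove_zero, finSuccEquiv'_succAbove]
  simp [consPerm, this]

theorem val_succAbove {n : ℕ} (p : Fin (n + 1)) (j : Fin n) :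
    (p.succAbove j : ℕ) = if (j : ℕ) < p then (j : ℕ) else j + 1 := by
  simp only [Fin.succAbove, Fin.lt_def, Fin.val_castSucc]
  split_ifs <;> rfl

theorem val_consPerm_zero {n : ℕ} (p : Fin (n + 1)) (ρ : Equiv.Perm (Fin n)) (h : 0 < n + 1) :
    (consPerm p ρ ⟨0, h⟩ : ℕ) = p :=
  congrArg Fin.val (consPerm_zero p ρ)

theorem val_consPerm_succ {n k : ℕ} (p : Fin (n + 1)) (ρ : Equiv.Perm (Fin n)) (h : k + 1 < n + 1) :
    (consPerm p ρ ⟨k + 1, h⟩ : ℕ) =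
      if (ρ ⟨k, by omega⟩ : ℕ) < p then (ρ ⟨k, by omega⟩ : ℕ) else ρ ⟨k, by omega⟩ + 1 := by
  have := consPerm_succ p ρ ⟨k, by omega⟩
  rw [← val_succAbove, ← this]
  rfl

theorem consPerm_injective {n : ℕ} :
    Function.Injective fun x : Fin (n + 1) × Equiv.Perm (Fin n) => consPerm x.1 x.2 := by
  rintro ⟨p, ρ⟩ ⟨p', ρ'⟩ h
  have h0 : p = p' := by simpa using congrArg (fun σ : Equiv.Perm (Fin (n + 1)) => σ 0) h
  subst h0
  refine Prod.ext rfl (Equiv.ext fun j => ?_)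
  have := congrArg (fun σ : Equiv.Perm (Fin (n + 1)) => σ j.succ) h
  simpa using this

/-- The injection is onto because (n+1) · n! = (n+1)!. -/
theorem exists_eq_consPerm {n : ℕ} (σ : Equiv.Perm (Fin (n + 1))) :
    ∃ p ρ, σ = consPerm p ρ := by
  have h := (Fintype.bijective_iff_injective_and_card
    (fun x : Fin (n + 1) × Equiv.Perm (Fin n) => consPerm x.1 x.2)).2
    ⟨consPerm_injective, by simp [Fintype.card_perm, Nat.factorial_succ]⟩
  obtain ⟨⟨p, ρ⟩, h⟩ := h.2 σ
  exact ⟨p, ρ, h.symm⟩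

theorem occursAt_consPerm {m n : ℕ} (τ : Equiv.Perm (Fin m)) (p : Fin (n + 1))
    (ρ : Equiv.Perm (Fin n)) (i : ℕ) : OccursAt τ (consPerm p ρ) (i + 1) ↔ OccursAt τ ρ i := by
  have key : ∀ (a b : ℕ) (ha : a < n) (hb : b < n) (a' b' : Fin (n + 1)), (a' : ℕ) = a + 1 →
      (b' : ℕ) = b + 1 → (consPerm p ρ a' < consPerm p ρ b' ↔ ρ ⟨a, ha⟩ < ρ ⟨b, hb⟩) := by
    intro a b ha hb a' b' ha' hb'
    obtain rfl : a' = Fin.succ ⟨a, ha⟩ := Fin.ext ha'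
    obtain rfl : b' = Fin.succ ⟨b, hb⟩ := Fin.ext hb'
    rw [consPerm_succ, consPerm_succ]
    exact (Fin.strictMono_succAbove p).lt_iff_lt
  constructor
  · rintro ⟨h, H⟩
    refine ⟨by omega, fun a b => ?_⟩
    rw [← H a b]
    exact (key _ _ _ _ _ _ (by simp; omega) (by simp; omega)).symm
  · rintro ⟨h, H⟩
    refine ⟨by omega, fun a b => ?_⟩
    rw [← H a b]
    exact key _ _ _ _ _ _ (by simp; omega) (by simp; omega)

theorem occursAt_pattern2413 {n : ℕ} (σ : Equiv.Perm (Fin n)) (i : ℕ) :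
    OccursAt pattern2413 σ i ↔ ∃ h : i + 4 ≤ n,
      (σ ⟨i + 2, by omega⟩ : ℕ) < σ ⟨i, by omega⟩ ∧
      (σ ⟨i, by omega⟩ : ℕ) < σ ⟨i + 3, by omega⟩ ∧
      (σ ⟨i + 3, by omega⟩ : ℕ) < σ ⟨i + 1, by omega⟩ := by
  constructor
  · rintro ⟨h, H⟩
    refine ⟨h, ?_, ?_, ?_⟩
    · exact (H 2 0).2 (by decide)
    · exact (H 0 3).2 (by decide)
    · exact (H 3 1).2 (by decide)
  · rintro ⟨h, h1, h2, h3⟩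
    refine ⟨h, fun a b => ?_⟩
    fin_cases a <;> fin_cases b <;>
      simp [pattern2413, Fin.lt_def, -Fin.val_fin_lt] <;> omega

/-! ### Deleting the entries before the second mark -/

theorem IsCluster.strictMono {m n l : ℕ} {τ : Equiv.Perm (Fin m)} {σ : Equiv.Perm (Fin n)}
    {i : Fin l → ℕ} (h : IsCluster τ σ i) : StrictMono i := by
  cases l with
  | zero => exact fun a => a.elim0
  | succ l => exact Fin.strictMono_iff_lt_succ.2 fun k => h.increasing k (by omega)

/-- The new mark 0 is linked to the next mark d because 0 < d < m. The condition `i 0 = 0` says that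
the second mark is exactly d, so that `ρ` begins at a mark. -/
theorem isCluster_cons {m n n' d l : ℕ} {τ : Equiv.Perm (Fin m)} {σ : Equiv.Perm (Fin n)}
    {ρ : Equiv.Perm (Fin n')} (hn : n = n' + d) (hd : 0 < d) (hdm : d < m)
    (hσ : ∀ j, OccursAt τ σ (j + d) ↔ OccursAt τ ρ j) (i : Fin (l + 1) → ℕ) :
    IsCluster τ σ (Fin.cons 0 fun k => i k + d : Fin (l + 2) → ℕ) ∧ i 0 = 0 ↔
      OccursAt τ σ 0 ∧ IsCluster τ ρ i := by
  set i' : Fin (l + 2) → ℕ := Fin.cons 0 fun k => i k + d with hi'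
  have e0 : ∀ h, i' ⟨0, h⟩ = 0 := fun h => rfl
  have es : ∀ k (h : k + 1 < l + 2), i' ⟨k + 1, h⟩ = i ⟨k, by omega⟩ + d := fun k h => rfl
  constructor
  · rintro ⟨H, h0⟩
    refine ⟨H.occurs 0, fun k => ?_, fun k h => ?_, fun k h => ?_, by omega, h0, ?_⟩
    · exact (hσ _).1 (H.occurs k.succ)
    · have := H.increasing (k + 1) (by omega)
      rw [es, es] at this
      omega
    · have := H.linked (k + 1) (by omega)
      rw [es, es] at this
      omega
    · obtain ⟨_, _, h⟩ := H.covered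
      have := es l (by omega)
      simp only [Nat.add_sub_cancel] at *
      have h2 : l + 2 - 1 = l + 1 := by omega
      omega
  · rintro ⟨h0, H⟩
    obtain ⟨_, hi0, hl⟩ := H.covered
    have hi0' : i 0 = 0 := hi0
    refine ⟨⟨fun k => ?_, fun k h => ?_, fun k h => ?_, by omega, rfl, ?_⟩, hi0⟩
    · refine Fin.cases ?_ (fun k => ?_) k
      · exact h0
      · exact (hσ _).2 (H.occurs k)
    · rcases k with _ | k
      · rw [e0, es]; omega
      · rw [es, es]
        have := H.increasing k (by omega)
        omega
    · rcases k with _ | k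
      · rw [e0, es, hi0]; omega
      · rw [es, es]
        have := H.linked k (by omega)
        omega
    · have := es l (by omega)
      simp only [Nat.add_sub_cancel] at *
      have h2 : l + 2 - 1 = l + 1 := by omega
      omega

theorem IsCluster.eq_cons {m n d l : ℕ} {τ : Equiv.Perm (Fin m)} {σ : Equiv.Perm (Fin n)}
    {i : Fin (l + 2) → ℕ} (h : IsCluster τ σ i) (hd : i 1 = d) :
    ∃ i' : Fin (l + 1) → ℕ, i = Fin.cons 0 (fun k => i' k + d) ∧ i' 0 = 0 := by
  refine ⟨fun k => i k.succ - d, ?_, ?_⟩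
  · ext k
    refine Fin.cases ?_ (fun k => ?_) k
    · exact h.covered.2.1
    · have : i 1 ≤ i k.succ := h.strictMono.monotone (by
        rw [Fin.le_def]; simp)
      simp only [Fin.cons_succ]
      omega
  · simp [← hd]

theorem IsCluster.second_mark {n l : ℕ} {σ : Equiv.Perm (Fin n)} {i : Fin (l + 2) → ℕ}
    (h : IsCluster pattern2413 σ i) : i 1 = 2 ∨ i 1 = 3 := by
  have h0 : i ⟨0, by omega⟩ = 0 := h.covered.2.1
  have h1 : i ⟨0, by omega⟩ < i 1 := h.increasing 0 (by omega)
  have h2 : i 1 < i ⟨0, by omega⟩ + 4 := h.linked 0 (by omega)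
  -- Occurrences at 0 and 1 would give σ₁ < σ₂ < σ₀ < σ₁.
  have h3 : i 1 ≠ 1 := by
    intro h3
    have o0 := h.occurs ⟨0, by omega⟩
    have o1 := h.occurs 1
    rw [h0, occursAt_pattern2413] at o0
    rw [h3, occursAt_pattern2413] at o1
    obtain ⟨_, a, b, c⟩ := o0
    obtain ⟨_, a', b', c'⟩ := o1
    simp only [Nat.reduceAdd] at *
    omega
  omega

theorem IsCluster.occursAt_zero {m n l : ℕ} {τ : Equiv.Perm (Fin m)} {σ : Equiv.Perm (Fin n)}
    {i : Fin l → ℕ} (h : IsCluster τ σ i) : OccursAt τ σ 0 := by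
  obtain ⟨hl, h0, -⟩ := h.covered
  rw [← h0]
  exact h.occurs _

/-! ### Refined cluster numbers and initial conditions -/

/-- Refined cluster numbers count clusters by their first two entries. -/
theorem ncard_clusters_eq_sum {m : ℕ} (τ : Equiv.Perm (Fin m)) (n l : ℕ) (F : Finset (ℕ × ℕ)) :
    {c : Equiv.Perm (Fin n) × (Fin l → ℕ) | IsCluster τ c.1 c.2 ∧ ∃ h : 2 ≤ n,
      ((c.1 ⟨0, by omega⟩ : ℕ) + 1, (c.1 ⟨1, by omega⟩ : ℕ) + 1) ∈ F}.ncard =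
      ∑ x ∈ F, refinedClusterNumber τ n l x.1 x.2 := by
  induction F using Finset.induction_on with
  | empty => simp
  | insert x F hx ih =>
    rw [Finset.sum_insert hx, ← ih, refinedClusterNumber, ← Set.ncard_union_eq ?_
      ((finite_clusters τ n l).subset fun c h => h.1)
      ((finite_clusters τ n l).subset fun c h => h.1)]
    · congr 1
      ext c
      simp only [Finset.mem_insert, Set.mem_ofPred_eq, Set.mem_union, Prod.ext_iff]
      constructor
      · rintro ⟨h, h2, h3 | h3⟩
        · exact Or.inl ⟨h, h2, h3⟩
        · exact Or.inr ⟨h, h2, h3⟩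
      · rintro (⟨h, h2, h3⟩ | ⟨h, h2, h3⟩)
        · exact ⟨h, h2, Or.inl h3⟩
        · exact ⟨h, h2, Or.inr h3⟩
    · rw [Set.disjoint_left]
      rintro c ⟨-, h2, h3⟩ ⟨-, h2', h3'⟩
      rw [h3.1, h3.2] at h3'
      exact hx h3'

/-- In the initial 2413 the entry playing 1 lies below p, and the one playing 3 lies strictly
between p and q. -/
theorem clusterNumber_pattern2413 (n l : ℕ) :
    clusterNumber pattern2413 n l =
      ∑ p ∈ Icc 2 n, ∑ q ∈ Icc (p + 2) n, refinedClusterNumber pattern2413 n l p q := by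
  have := ncard_clusters_eq_sum pattern2413 n l
    (((Icc 2 n).sigma fun p => Icc (p + 2) n).map (Equiv.sigmaEquivProd ℕ ℕ).toEmbedding)
  rw [Finset.sum_map, Finset.sum_sigma] at this
  refine Eq.trans ?_ this
  rw [clusterNumber]
  congr 1
  ext ⟨σ, i⟩
  simp only [Set.mem_ofPred_eq]
  refine ⟨fun h => ⟨h, ?_⟩, fun h => h.1⟩
  have h0 := h.occursAt_zero
  rw [occursAt_pattern2413] at h0
  obtain ⟨hn, h1, h2, h3⟩ := h0
  refine ⟨by omega, ?_⟩
  simp only [Finset.mem_map, Finset.mem_sigma, Finset.mem_Icc]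
  refine ⟨⟨_, _⟩, ⟨⟨?_, ?_⟩, ?_, ?_⟩, rfl⟩ <;> simp only [Nat.zero_add] at * <;> omega

theorem refinedClusterNumber_eq_zero {m : ℕ} (τ : Equiv.Perm (Fin m)) {n l p q : ℕ}
    (h : ∀ (σ : Equiv.Perm (Fin n)) (i : Fin l → ℕ) (hn : 2 ≤ n), IsCluster τ σ i →
      (σ ⟨0, by omega⟩ : ℕ) + 1 = p → (σ ⟨1, by omega⟩ : ℕ) + 1 = q → False) :
    refinedClusterNumber τ n l p q = 0 := by
  rw [refinedClusterNumber, Set.ncard_eq_zero ((finite_clusters τ n l).subset fun c h => h.1),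
    Set.eq_empty_iff_forall_notMem]
  rintro ⟨σ, i⟩ ⟨hc, hn, hp, hq⟩
  exact h σ i hn hc hp hq

theorem refinedClusterNumber_zero_right {m : ℕ} (τ : Equiv.Perm (Fin m)) (n p q : ℕ) :
    refinedClusterNumber τ n 0 p q = 0 :=
  refinedClusterNumber_eq_zero τ fun _ _ _ h _ _ => absurd h.covered.1 (lt_irrefl 0)

theorem refinedClusterNumber_eq_zero_of_lt {m : ℕ} (τ : Equiv.Perm (Fin m)) {n : ℕ} (hn : n < m)
    (l p q : ℕ) : refinedClusterNumber τ n l p q = 0 :=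
  refinedClusterNumber_eq_zero τ fun _ _ _ h _ _ => by
    obtain ⟨h, -⟩ := h.occursAt_zero
    omega

/-- A single mark is both first and last, so its occurrence fills the permutation. -/
theorem refinedClusterNumber_one {m : ℕ} (τ : Equiv.Perm (Fin m)) {n : ℕ} (hn : n ≠ m)
    (p q : ℕ) : refinedClusterNumber τ n 1 p q = 0 :=
  refinedClusterNumber_eq_zero τ fun _ _ _ h _ _ => by
    obtain ⟨_, h0, h⟩ := h.covered
    simp only [Nat.sub_self] at h
    omega

theorem refinedClusterNumber_four (l p q : ℕ) :
    refinedClusterNumber pattern2413 4 l p q = if l = 1 ∧ p = 2 ∧ q = 4 then 1 else 0 := by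
  have key : ∀ (σ : Equiv.Perm (Fin 4)) (i : Fin l → ℕ), IsCluster pattern2413 σ i →
      l = 1 ∧ σ = pattern2413 ∧ ∀ k, i k = 0 := by
    intro σ i h
    obtain ⟨hl, h0, h4⟩ := h.covered
    have hl1 : l = 1 := by
      by_contra hl1
      have := h.strictMono (a := ⟨0, hl⟩) (b := ⟨l - 1, by omega⟩) (by
        rw [Fin.lt_def]; simp only; omega)
      omega
    refine ⟨hl1, ?_, fun k => ?_⟩
    · have o := h.occursAt_zero
      rw [occursAt_pattern2413] at o
      obtain ⟨_, a, b, c⟩ := o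
      have a : (σ 2 : ℕ) < σ 0 := a
      have b : (σ 0 : ℕ) < σ 3 := b
      have c : (σ 3 : ℕ) < σ 1 := c
      have h1 := (σ 1).2
      have e0 : (σ 0 : ℕ) = 1 := by omega
      have e1 : (σ 1 : ℕ) = 3 := by omega
      have e2 : (σ 2 : ℕ) = 0 := by omega
      have e3 : (σ 3 : ℕ) = 2 := by omega
      ext j
      fin_cases j
      exacts [e0, e1, e2, e3]
    · subst hl1
      rw [← h0]
      congr 1
      exact Subsingleton.elim _ _
  split_ifs with h
  · obtain ⟨rfl, rfl, rfl⟩ := h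
    rw [refinedClusterNumber, Set.ncard_eq_one]
    refine ⟨(pattern2413, fun _ => 0), ?_⟩
    ext ⟨σ, i⟩
    simp only [Set.mem_ofPred_eq, Set.mem_singleton_iff, Prod.mk.injEq]
    constructor
    · rintro ⟨h, -⟩
      obtain ⟨-, h1, h2⟩ := key σ i h
      exact ⟨h1, funext h2⟩
    · rintro ⟨rfl, rfl⟩
      refine ⟨⟨fun k => ⟨by omega, fun a b => ?_⟩, fun k h => by omega, fun k h => by omega,
        by omega, rfl, rfl⟩, by omega, by decide, by decide⟩
      simp
  · refine refinedClusterNumber_eq_zero _ fun σ i hn hc hp hq => h ?_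
    obtain ⟨h1, rfl, -⟩ := key σ i hc
    refine ⟨h1, ?_, ?_⟩
    · exact hp.symm
    · exact hq.symm

/-! ### The recurrence, by the distance to the second mark -/

/-- Clusters whose first two entries are `a < b + 1` and whose second mark is two places after the
first one. -/
theorem ncard_clusters_second_mark_two {n l : ℕ} (a : Fin (n + 2)) (b : Fin (n + 1))
    (hab : (a : ℕ) ≤ b) :
    {c : Equiv.Perm (Fin (n + 2)) × (Fin (l + 2) → ℕ) | (IsCluster pattern2413 c.1 c.2 ∧
      (c.1 ⟨0, by omega⟩ : ℕ) = a ∧ (c.1 ⟨1, by omega⟩ : ℕ) = b + 1) ∧ c.2 1 = 2}.ncard =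
    {c : Equiv.Perm (Fin n) × (Fin (l + 1) → ℕ) | IsCluster pattern2413 c.1 c.2 ∧
      ∃ h : 2 ≤ n, (c.1 ⟨0, by omega⟩ : ℕ) < a ∧ (a : ℕ) ≤ c.1 ⟨1, by omega⟩ ∧
        (c.1 ⟨1, by omega⟩ : ℕ) < b}.ncard := by
  -- `b` is inserted before `a`; as `a ≤ b`, inserting `a` raises it to `b + 1`.
  set Ψ : Equiv.Perm (Fin n) × (Fin (l + 1) → ℕ) →
      Equiv.Perm (Fin (n + 2)) × (Fin (l + 2) → ℕ) :=
    fun c => (consPerm a (consPerm b c.1), Fin.cons 0 fun k => c.2 k + 2)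
  have hinj : Function.Injective Ψ := by
    rintro ⟨ρ, i⟩ ⟨ρ', i'⟩ h
    obtain ⟨h1, h2⟩ := Prod.mk.inj h
    have h1' := consPerm_injective (a₁ := (b, ρ)) (a₂ := (b, ρ'))
      (Prod.mk.inj (consPerm_injective (a₁ := (a, _)) (a₂ := (a, _)) h1)).2
    refine Prod.ext (Prod.mk.inj h1').2 (funext fun k => ?_)
    have := congrFun (Fin.cons_injective2 h2).2 k
    simp only at this ⊢
    omega
  have hocc : ∀ ρ : Equiv.Perm (Fin n), ∀ j,
      OccursAt pattern2413 (consPerm a (consPerm b ρ)) (j + 2) ↔ OccursAt pattern2413 ρ j :=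
    fun ρ j => by rw [← occursAt_consPerm _ b ρ, ← occursAt_consPerm _ a]
  -- The first remaining entry lies below `a`, so both insertions fix it; the second is fixed by `b`
  -- and raised once by `a`.
  have hzero : ∀ ρ : Equiv.Perm (Fin n), OccursAt pattern2413 (consPerm a (consPerm b ρ)) 0 ↔
      ∃ h : 2 ≤ n, (ρ ⟨0, by omega⟩ : ℕ) < a ∧ (a : ℕ) ≤ ρ ⟨1, by omega⟩ ∧
        (ρ ⟨1, by omega⟩ : ℕ) < b := by
    intro ρ
    rw [occursAt_pattern2413]
    simp only [Nat.zero_add]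
    constructor
    · rintro ⟨h, H⟩
      refine ⟨by omega, ?_⟩
      simp only [val_consPerm_zero, val_consPerm_succ] at H
      split_ifs at H <;> omega
    · rintro ⟨h, H⟩
      refine ⟨by omega, ?_⟩
      simp only [val_consPerm_zero, val_consPerm_succ]
      split_ifs <;> omega
  rw [← Set.ncard_image_of_injective _ hinj]
  congr 1
  ext ⟨σ, i⟩
  simp only [Set.mem_ofPred_eq, Set.mem_image, Prod.exists]
  constructor
  · rintro ⟨⟨hc, hp, hq⟩, h2⟩
    obtain ⟨i', rfl, h0⟩ := hc.eq_cons h2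
    obtain ⟨a', ρ', rfl⟩ := exists_eq_consPerm σ
    obtain ⟨b', ρ, rfl⟩ := exists_eq_consPerm ρ'
    simp only [val_consPerm_zero, val_consPerm_succ] at hp hq
    obtain rfl : a' = a := Fin.ext hp
    obtain rfl : b' = b := by
      apply Fin.ext
      split_ifs at hq <;> omega
    have := (isCluster_cons rfl (by omega) (by omega) (hocc ρ) i').1 ⟨hc, h0⟩
    exact ⟨ρ, i', ⟨this.2, (hzero ρ).1 this.1⟩, rfl⟩
  · rintro ⟨ρ, i', ⟨hc, h⟩, heq⟩
    obtain ⟨rfl, rfl⟩ := Prod.mk.inj heq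
    have := (isCluster_cons rfl (by omega) (by omega) (hocc ρ) i').2 ⟨(hzero ρ).2 h, hc⟩
    refine ⟨⟨this.1, ?_, ?_⟩, ?_⟩
    · exact val_consPerm_zero _ _ _
    · simp only [val_consPerm_zero, val_consPerm_succ]
      split_ifs <;> omega
    · change i' 0 + 2 = 2
      rw [this.2]

/-- Clusters whose first two entries are `a < b + 1` and whose second mark is three places after the
first one. -/
theorem ncard_clusters_second_mark_three {n l : ℕ} (a : Fin (n + 3)) (b : Fin (n + 2))
    (hab : (a : ℕ) ≤ b) :
    {c : Equiv.Perm (Fin (n + 3)) × (Fin (l + 2) → ℕ) | (IsCluster pattern2413 c.1 c.2 ∧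
      (c.1 ⟨0, by omega⟩ : ℕ) = a ∧ (c.1 ⟨1, by omega⟩ : ℕ) = b + 1) ∧ c.2 1 = 3}.ncard =
    a * {c : Equiv.Perm (Fin n) × (Fin (l + 1) → ℕ) | IsCluster pattern2413 c.1 c.2 ∧
      ∃ h : 1 ≤ n, (a : ℕ) ≤ c.1 ⟨0, by omega⟩ + 1 ∧ (c.1 ⟨0, by omega⟩ : ℕ) + 1 < b}.ncard := by
  set Ψ : Fin (n + 1) × (Equiv.Perm (Fin n) × (Fin (l + 1) → ℕ)) →
      Equiv.Perm (Fin (n + 3)) × (Fin (l + 2) → ℕ) :=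
    fun c => (consPerm a (consPerm b (consPerm c.1 c.2.1)), Fin.cons 0 fun k => c.2.2 k + 3)
  have hinj : Function.Injective Ψ := by
    rintro ⟨u, ρ, i⟩ ⟨u', ρ', i'⟩ h
    obtain ⟨h1, h2⟩ := Prod.mk.inj h
    have h1' := consPerm_injective (a₁ := (b, _)) (a₂ := (b, _))
      (Prod.mk.inj (consPerm_injective (a₁ := (a, _)) (a₂ := (a, _)) h1)).2
    have h1'' := consPerm_injective (a₁ := (u, ρ)) (a₂ := (u', ρ')) (Prod.mk.inj h1').2
    obtain ⟨rfl, rfl⟩ := Prod.mk.inj h1''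
    refine Prod.ext rfl (Prod.ext rfl (funext fun k => ?_))
    have := congrFun (Fin.cons_injective2 h2).2 k
    simp only at this ⊢
    omega
  have hocc : ∀ (u : Fin (n + 1)) (ρ : Equiv.Perm (Fin n)), ∀ j,
      OccursAt pattern2413 (consPerm a (consPerm b (consPerm u ρ))) (j + 3) ↔
        OccursAt pattern2413 ρ j :=
    fun u ρ j => by
      rw [← occursAt_consPerm _ u ρ, ← occursAt_consPerm _ b, ← occursAt_consPerm _ a]
  -- The third entry `u` lies below `a`; the fourth is raised by `u` and `a` but not by `b`. The
  -- fifth is outside the occurrence, hence free.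
  have hzero : ∀ (u : Fin (n + 1)) (ρ : Equiv.Perm (Fin n)),
      OccursAt pattern2413 (consPerm a (consPerm b (consPerm u ρ))) 0 ↔ (u : ℕ) < a ∧
      ∃ h : 1 ≤ n, (a : ℕ) ≤ ρ ⟨0, by omega⟩ + 1 ∧ (ρ ⟨0, by omega⟩ : ℕ) + 1 < b := by
    intro u ρ
    rw [occursAt_pattern2413]
    simp only [Nat.zero_add]
    constructor
    · rintro ⟨h, H⟩
      rw [exists_prop_of_true (by omega)]
      simp only [val_consPerm_zero, val_consPerm_succ] at H
      split_ifs at H <;> omega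
    · rintro ⟨hu, h, H⟩
      refine ⟨by omega, ?_⟩
      simp only [val_consPerm_zero, val_consPerm_succ]
      split_ifs <;> omega
  -- The choices of `u` give the factor p - 1, since `a` is the 0-based p.
  have hcard : {u : Fin (n + 1) | (u : ℕ) < a}.ncard = a := by
    rw [← Set.ncard_image_of_injective _ Fin.val_injective]
    have : Fin.val '' {u : Fin (n + 1) | (u : ℕ) < a} = ↑(range (a : ℕ)) := by
      ext x
      simp only [Set.mem_image, Set.mem_ofPred_eq, Finset.coe_range, Set.mem_Iio]
      exact ⟨by rintro ⟨u, h, rfl⟩; exact h, fun h => ⟨⟨x, by omega⟩, h, rfl⟩⟩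
    rw [this, Set.ncard_coe_finset, card_range]
  rw [show ∀ x : ℕ, (a : ℕ) * x = {u : Fin (n + 1) | (u : ℕ) < a}.ncard * x from
    fun x => by rw [hcard], ← Set.ncard_prod, ← Set.ncard_image_of_injective _ hinj]
  congr 1
  ext ⟨σ, i⟩
  simp only [Set.mem_ofPred_eq, Set.mem_image, Prod.exists, Set.mem_prod]
  constructor
  · rintro ⟨⟨hc, hp, hq⟩, h2⟩
    obtain ⟨i', rfl, h0⟩ := hc.eq_cons h2
    obtain ⟨a', ρ', rfl⟩ := exists_eq_consPerm σ
    obtain ⟨b', ρ'', rfl⟩ := exists_eq_consPerm ρ'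
    obtain ⟨u, ρ, rfl⟩ := exists_eq_consPerm ρ''
    simp only [val_consPerm_zero, val_consPerm_succ] at hp hq
    obtain rfl : a' = a := Fin.ext hp
    obtain rfl : b' = b := by
      apply Fin.ext
      split_ifs at hq <;> omega
    have := (isCluster_cons rfl (by omega) (by omega) (hocc u ρ) i').1 ⟨hc, h0⟩
    have hz := (hzero u ρ).1 this.1
    exact ⟨u, ρ, i', ⟨hz.1, this.2, hz.2⟩, rfl⟩
  · rintro ⟨u, ρ, i', ⟨hu, hc, h⟩, heq⟩
    obtain ⟨rfl, rfl⟩ := Prod.mk.inj heq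
    have := (isCluster_cons rfl (by omega) (by omega) (hocc u ρ) i').2 ⟨(hzero u ρ).2 ⟨hu, h⟩, hc⟩
    refine ⟨⟨this.1, ?_, ?_⟩, ?_⟩
    · exact val_consPerm_zero _ _ _
    · simp only [val_consPerm_zero, val_consPerm_succ]
      split_ifs <;> omega
    · change i' 0 + 3 = 3
      rw [this.2]

theorem IsCluster.head_lt {n l : ℕ} {σ : Equiv.Perm (Fin n)} {i : Fin l → ℕ}
    (h : IsCluster pattern2413 σ i) :
    ∃ hn : 4 ≤ n, (σ ⟨0, by omega⟩ : ℕ) < σ ⟨1, by omega⟩ := by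
  obtain ⟨hn, h1, h2, h3⟩ := (occursAt_pattern2413 σ 0).1 h.occursAt_zero
  exact ⟨by omega, by simp only [Nat.zero_add] at *; omega⟩

/-- `f` carries the index shifts of the recurrence. Truncated subtraction is not injective on ℕ, so
injectivity is only asked for on the summation range. -/
theorem sum_sum_refinedClusterNumber {m : ℕ} (τ : Equiv.Perm (Fin m)) (n l : ℕ) (R : Finset ℕ)
    (S : ℕ → Finset ℕ) (f : ℕ × ℕ → ℕ × ℕ)
    (hf : ∀ r ∈ R, ∀ s ∈ S r, ∀ r' ∈ R, ∀ s' ∈ S r', f (r, s) = f (r', s') → r = r' ∧ s = s') :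
    ∑ r ∈ R, ∑ s ∈ S r, refinedClusterNumber τ n l (f (r, s)).1 (f (r, s)).2 =
      {c : Equiv.Perm (Fin n) × (Fin l → ℕ) | IsCluster τ c.1 c.2 ∧ ∃ h : 2 ≤ n,
        ∃ r ∈ R, ∃ s ∈ S r,
          f (r, s) = ((c.1 ⟨0, by omega⟩ : ℕ) + 1, (c.1 ⟨1, by omega⟩ : ℕ) + 1)}.ncard := by
  have h1 := ncard_clusters_eq_sum τ n l ((R.sigma S).image fun x => f (x.1, x.2))
  rw [Finset.sum_image, Finset.sum_sigma] at h1
  · refine h1.symm.trans ?_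
    congr 1
    ext c
    simp only [Finset.mem_image, Finset.mem_sigma, Sigma.exists, Set.mem_ofPred_eq]
    constructor
    · rintro ⟨hc, hn, r, s, ⟨hr, hs⟩, e⟩
      exact ⟨hc, hn, r, hr, s, hs, e⟩
    · rintro ⟨hc, hn, r, hr, s, hs, e⟩
      exact ⟨hc, hn, r, s, ⟨hr, hs⟩, e⟩
  · rintro ⟨r, s⟩ h ⟨r', s'⟩ h' e
    simp only [Finset.coe_sigma, Set.mem_sigma_iff, Finset.mem_coe] at h h'
    obtain ⟨rfl, rfl⟩ := hf r h.1 s h.2 r' h'.1 s' h'.2 e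
    rfl

theorem ncard_second_mark_two_eq_sum {n l p q : ℕ} (hn : 5 ≤ n) (hp : 1 ≤ p) (hpq : p < q)
    (hq : q ≤ n) :
    {c : Equiv.Perm (Fin n) × (Fin (l + 2) → ℕ) | (IsCluster pattern2413 c.1 c.2 ∧ ∃ _ : 2 ≤ n,
      (c.1 ⟨0, by omega⟩ : ℕ) + 1 = p ∧ (c.1 ⟨1, by omega⟩ : ℕ) + 1 = q) ∧ c.2 1 = 2}.ncard =
    ∑ r ∈ Finset.Ico 1 p, ∑ s ∈ Finset.Ioo p q,
      refinedClusterNumber pattern2413 (n - 2) (l + 1) r (s - 1) := by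
  obtain ⟨n, rfl⟩ : ∃ k, n = k + 2 := ⟨n - 2, by omega⟩
  obtain ⟨p, rfl⟩ : ∃ k, p = k + 1 := ⟨p - 1, by omega⟩
  -- One unit makes q 0-based, the other undoes the shift caused by inserting p.
  obtain ⟨q, rfl⟩ : ∃ k, q = k + 2 := ⟨q - 2, by omega⟩
  have h := ncard_clusters_second_mark_two (n := n) (l := l) ⟨p, by omega⟩ ⟨q, by omega⟩
    (by simp only; omega)
  have h2 := sum_sum_refinedClusterNumber pattern2413 n (l + 1) (Ico 1 (p + 1))
    (fun _ => Ioo (p + 1) (q + 2)) (fun x => (x.1, x.2 - 1)) (by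
      intro r hr s hs r' hr' s' hs' e
      simp only [Finset.mem_Ioo, Prod.mk.injEq] at *
      omega)
  rw [show n + 2 - 2 = n from rfl, h2]
  convert h using 2
  · ext c
    simp only [Set.mem_ofPred_eq]
    constructor
    · rintro ⟨⟨hc, -, h1, h2⟩, h3⟩
      exact ⟨⟨hc, by omega, by omega⟩, h3⟩
    · rintro ⟨⟨hc, h1, h2⟩, h3⟩
      exact ⟨⟨hc, by omega, by omega, by omega⟩, h3⟩
  · ext c
    simp only [Set.mem_ofPred_eq, Finset.mem_Ico, Finset.mem_Ioo, Prod.mk.injEq]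
    refine and_congr_right fun _ => exists_congr fun hn => ?_
    constructor
    · rintro ⟨r, hr, s, hs, e⟩
      omega
    · rintro ⟨h1, h2, h3⟩
      exact ⟨_, ⟨by omega, by omega⟩, (c.1 ⟨1, by omega⟩ : ℕ) + 2, ⟨by omega, by omega⟩, rfl,
        by omega⟩

theorem ncard_second_mark_three_eq_sum {n l p q : ℕ} (hn : 5 ≤ n) (hp : 1 ≤ p) (hpq : p < q)
    (hq : q ≤ n) :
    {c : Equiv.Perm (Fin n) × (Fin (l + 2) → ℕ) | (IsCluster pattern2413 c.1 c.2 ∧ ∃ _ : 2 ≤ n,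
      (c.1 ⟨0, by omega⟩ : ℕ) + 1 = p ∧ (c.1 ⟨1, by omega⟩ : ℕ) + 1 = q) ∧ c.2 1 = 3}.ncard =
    (∑ r ∈ Finset.Ioo p q, ∑ s ∈ Finset.Ioo r q, (p - 1) * refinedClusterNumber pattern2413
        (n - 3) (l + 1) (r - 2) (s - 2)) +
    (∑ r ∈ Finset.Ioo p q, ∑ s ∈ Finset.Ioc q n, (p - 1) * refinedClusterNumber pattern2413
        (n - 3) (l + 1) (r - 2) (s - 3)) := by
  obtain ⟨n, rfl⟩ : ∃ k, n = k + 3 := ⟨n - 3, by omega⟩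
  obtain ⟨p, rfl⟩ : ∃ k, p = k + 1 := ⟨p - 1, by omega⟩
  obtain ⟨q, rfl⟩ : ∃ k, q = k + 2 := ⟨q - 2, by omega⟩
  have h := ncard_clusters_second_mark_three (n := n) (l := l) ⟨p, by omega⟩ ⟨q, by omega⟩
    (by simp only; omega)
  simp_rw [← Finset.mul_sum]
  rw [← mul_add, Nat.add_sub_cancel, Nat.add_sub_cancel]
  refine Eq.trans ?_ (h.trans ?_)
  · congr 1
    ext c
    simp only [Set.mem_ofPred_eq]
    constructor
    · rintro ⟨⟨hc, -, h1, h2⟩, h3⟩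
      exact ⟨⟨hc, by omega, by omega⟩, h3⟩
    · rintro ⟨⟨hc, h1, h2⟩, h3⟩
      exact ⟨⟨hc, by omega, by omega, by omega⟩, h3⟩
  rcases Nat.eq_zero_or_pos p with rfl | hp0
  · simp
  congr 1
  have h2 := sum_sum_refinedClusterNumber pattern2413 n (l + 1) (Ioo (p + 1) (q + 2))
    (fun r => Ioo r (q + 2)) (fun x => (x.1 - 2, x.2 - 2)) (by
      intro r hr s hs r' hr' s' hs' e
      simp only [Finset.mem_Ioo, Prod.mk.injEq] at *
      omega)
  have h3 := sum_sum_refinedClusterNumber pattern2413 n (l + 1) (Ioo (p + 1) (q + 2))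
    (fun r => Ioc (q + 2) (n + 3)) (fun x => (x.1 - 2, x.2 - 3)) (by
      intro r hr s hs r' hr' s' hs' e
      simp only [Finset.mem_Ioo, Finset.mem_Ioc, Prod.mk.injEq] at *
      omega)
  rw [h2, h3, ← Set.ncard_union_eq ?_ ((finite_clusters _ _ _).subset fun c h => h.1)
    ((finite_clusters _ _ _).subset fun c h => h.1)]
  · congr 1
    ext c
    simp only [Set.mem_ofPred_eq, Finset.mem_Ioo, Finset.mem_Ioc, Prod.mk.injEq, Set.mem_union]
    constructor
    · rintro ⟨hc, hn1, h1, h2⟩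
      -- A cluster begins with an ascent, so r < s needs no separate condition. The insertions of
      -- `u` and p and the 1-based values add 3 to both entries; s gains one more if it passes q.
      obtain ⟨hn4, hlt⟩ := hc.head_lt
      have hb := (c.1 ⟨1, by omega⟩).2
      by_cases hs : (c.1 ⟨1, by omega⟩ : ℕ) + 3 < q + 2
      · exact Or.inl ⟨hc, by omega, (c.1 ⟨0, by omega⟩ : ℕ) + 3, ⟨by omega, by omega⟩,
          (c.1 ⟨1, by omega⟩ : ℕ) + 3, ⟨by omega, by omega⟩, by omega, by omega⟩
      · exact Or.inr ⟨hc, by omega, (c.1 ⟨0, by omega⟩ : ℕ) + 3, ⟨by omega, by omega⟩,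
          (c.1 ⟨1, by omega⟩ : ℕ) + 4, ⟨by omega, by omega⟩, by omega, by omega⟩
    · rintro (⟨hc, hn, r, hr, s, hs, e⟩ | ⟨hc, hn, r, hr, s, hs, e⟩)
      · exact ⟨hc, by omega, by omega, by omega⟩
      · exact ⟨hc, by omega, by omega, by omega⟩
  · rw [Set.disjoint_left]
    rintro c ⟨-, _, r, hr, s, hs, e⟩ ⟨-, _, r', hr', s', hs', e'⟩
    simp only [Finset.mem_Ioo, Finset.mem_Ioc, Prod.mk.injEq] at *
    omega

theorem refinedClusterNumber_recurrence {n l p q : ℕ} (hn : 5 ≤ n) (hl : 1 ≤ l) (hp : 1 ≤ p)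
    (hq : q ≤ n) :
    refinedClusterNumber pattern2413 n l p q =
      (∑ r ∈ Finset.Ico 1 p, ∑ s ∈ Finset.Ioo p q,
        refinedClusterNumber pattern2413 (n - 2) (l - 1) r (s - 1)) +
      (∑ r ∈ Finset.Ioo p q, ∑ s ∈ Finset.Ioo r q,
        (p - 1) * refinedClusterNumber pattern2413 (n - 3) (l - 1) (r - 2) (s - 2)) +
      (∑ r ∈ Finset.Ioo p q, ∑ s ∈ Finset.Ioc q n,
        (p - 1) * refinedClusterNumber pattern2413 (n - 3) (l - 1) (r - 2) (s - 3)) := by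
  rcases le_or_gt q p with hpq | hpq
  · rw [Finset.Ioo_eq_empty (by omega), refinedClusterNumber_eq_zero]
    · simp
    · intro σ i _ hc h1 h2
      obtain ⟨_, h⟩ := hc.head_lt
      omega
  obtain rfl | ⟨l, rfl⟩ : l = 1 ∨ ∃ k, l = k + 2 := by
    rcases l with _ | _ | l
    · omega
    · exact Or.inl rfl
    · exact Or.inr ⟨l, rfl⟩
  -- For l = 1 the right side vanishes as there are no 0-clusters, the left because n ≠ 4.
  · rw [refinedClusterNumber_one _ (by omega)]
    simp [refinedClusterNumber_zero_right]
  rw [show l + 2 - 1 = l + 1 from rfl, ← ncard_second_mark_two_eq_sum hn hp hpq hq, add_assoc,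
    ← ncard_second_mark_three_eq_sum hn hp hpq hq, ← Set.ncard_union_eq ?_
    ((finite_clusters _ _ _).subset fun c h => h.1.1)
    ((finite_clusters _ _ _).subset fun c h => h.1.1), refinedClusterNumber]
  · congr 1
    ext c
    simp only [Set.mem_ofPred_eq, Set.mem_union]
    constructor
    · intro h
      exact h.1.second_mark.imp (fun e => ⟨h, e⟩) fun e => ⟨h, e⟩
    · rintro (h | h) <;> exact h.1
  · rw [Set.disjoint_left]
    rintro c ⟨-, h⟩ ⟨-, h'⟩
    omega

/-! ### Independence of occurrences in disjoint blocks -/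

/-- Every injective word has a standardization. -/
theorem exists_standardization {k : ℕ} {α : Type*} [LinearOrder α] (f : Fin k → α)
    (hf : Function.Injective f) :
    ∃ ρ : Equiv.Perm (Fin k), ∀ x y, f x < f y ↔ ρ x < ρ y := by
  refine ⟨(Tuple.sort f)⁻¹, fun x y => ?_⟩
  have hmono : StrictMono (f ∘ Tuple.sort f) :=
    (Tuple.monotone_sort f).strictMono_of_injective (hf.comp (Equiv.injective _))
  rw [← hmono.lt_iff_lt]
  simp

theorem occursAt_add_iff {m n k d : ℕ} (τ : Equiv.Perm (Fin m)) {σ : Equiv.Perm (Fin n)}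
    {ρ : Equiv.Perm (Fin k)} (hd : d + k ≤ n)
    (h : ∀ x y : Fin k, σ ⟨d + x, by omega⟩ < σ ⟨d + y, by omega⟩ ↔ ρ x < ρ y) {s : ℕ}
    (hs : s + m ≤ k) : OccursAt τ σ (d + s) ↔ OccursAt τ ρ s := by
  have key : ∀ a b : Fin m, σ ⟨d + s + a, by omega⟩ < σ ⟨d + s + b, by omega⟩ ↔
      ρ ⟨s + a, by omega⟩ < ρ ⟨s + b, by omega⟩ := by
    intro a b
    rw [← h]
    simp only [add_assoc]
  constructor
  · rintro ⟨_, H⟩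
    exact ⟨hs, fun a b => (key a b).symm.trans (H a b)⟩
  · rintro ⟨_, H⟩
    exact ⟨by omega, fun a b => (key a b).trans (H a b)⟩

open Classical in
/-- The number of permutations of length `n` in which `τ` occurs at all the positions in `S`. -/
noncomputable def markedNumber {m : ℕ} (τ : Equiv.Perm (Fin m)) (n : ℕ) (S : Finset ℕ) : ℕ :=
  #{σ : Equiv.Perm (Fin n) | ∀ s ∈ S, OccursAt τ σ s}

/-- The permutation of `Fin (k + j)` acting as `α` on the first `k` elements and as `β` on the last
`j` ones. -/
def blockPerm {k j : ℕ} (α : Equiv.Perm (Fin k)) (β : Equiv.Perm (Fin j)) :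
    Equiv.Perm (Fin (k + j)) :=
  finSumFinEquiv.permCongr (Equiv.sumCongr α β)

@[simp] theorem blockPerm_castAdd {k j : ℕ} (α : Equiv.Perm (Fin k)) (β : Equiv.Perm (Fin j))
    (x : Fin k) : blockPerm α β (Fin.castAdd j x) = Fin.castAdd j (α x) := by
  simp [blockPerm, Equiv.permCongr_apply]

@[simp] theorem blockPerm_natAdd {k j : ℕ} (α : Equiv.Perm (Fin k)) (β : Equiv.Perm (Fin j))
    (x : Fin j) : blockPerm α β (Fin.natAdd k x) = Fin.natAdd k (β x) := by
  simp [blockPerm, Equiv.permCongr_apply]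

/-- The position sets of two consecutive blocks, the first one of length `k`. -/
def joinMarks (k : ℕ) (S T : Finset ℕ) : Finset ℕ := S ∪ T.map (addLeftEmbedding k)

theorem mem_joinMarks {k a : ℕ} {S T : Finset ℕ} :
    a ∈ joinMarks k S T ↔ a ∈ S ∨ ∃ b ∈ T, k + b = a := by
  simp [joinMarks]

/-- Right multiplication by `blockPerm α β` rearranges positions inside each block, hence multiplies
the standardizations of the two blocks of `σ` by `α` and `β`. -/
theorem exists_forall_occursAt_mul_blockPerm {m k j : ℕ} (τ : Equiv.Perm (Fin m))
    (S T : Finset ℕ) (hS : ∀ s ∈ S, s + m ≤ k) (hT : ∀ s ∈ T, s + m ≤ j)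
    (σ : Equiv.Perm (Fin (k + j))) :
    ∃ (ρ₁ : Equiv.Perm (Fin k)) (ρ₂ : Equiv.Perm (Fin j)), ∀ α β,
      (∀ s ∈ joinMarks k S T, OccursAt τ (σ * blockPerm α β) s) ↔
        (∀ s ∈ S, OccursAt τ (ρ₁ * α) s) ∧ ∀ s ∈ T, OccursAt τ (ρ₂ * β) s := by
  obtain ⟨ρ₁, h₁⟩ := exists_standardization (fun x : Fin k => σ (Fin.castAdd j x))
    (σ.injective.comp (Fin.castAdd_injective k j))
  obtain ⟨ρ₂, h₂⟩ := exists_standardization (fun x : Fin j => σ (Fin.natAdd k x))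
    (σ.injective.comp (Fin.natAdd_injective j k))
  refine ⟨ρ₁, ρ₂, fun α β => ?_⟩
  have e₁ : ∀ s ∈ S, (OccursAt τ (σ * blockPerm α β) s ↔ OccursAt τ (ρ₁ * α) s) := by
    intro s hs
    have := occursAt_add_iff τ (d := 0) (σ := σ * blockPerm α β) (ρ := ρ₁ * α) (by omega)
      (fun x y => ?_) (hS s hs)
    · rwa [Nat.zero_add] at this
    · have hx : ∀ (x : Fin k) h, (⟨0 + x, h⟩ : Fin (k + j)) = Fin.castAdd j x :=
        fun x h => Fin.ext (by simp)
      rw [hx, hx]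
      simp [h₁]
  have e₂ : ∀ s ∈ T, (OccursAt τ (σ * blockPerm α β) (k + s) ↔ OccursAt τ (ρ₂ * β) s) := by
    intro s hs
    refine occursAt_add_iff τ le_rfl (fun x y => ?_) (hT s hs)
    have hx : ∀ (x : Fin j) h, (⟨k + x, h⟩ : Fin (k + j)) = Fin.natAdd k x :=
      fun x h => rfl
    rw [hx, hx]
    simp [h₂]
  constructor
  · intro h
    exact ⟨fun s hs => (e₁ s hs).1 (h s (mem_joinMarks.2 (Or.inl hs))),
      fun s hs => (e₂ s hs).1 (h _ (mem_joinMarks.2 (Or.inr ⟨s, hs, rfl⟩)))⟩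
  · rintro ⟨hl, hr⟩ s hs
    rcases mem_joinMarks.1 hs with hs | ⟨t, ht, rfl⟩
    · exact (e₁ s hs).2 (hl s hs)
    · exact (e₂ t ht).2 (hr t ht)

/-- Double count of the (σ, α, β) for which `σ * blockPerm α β` has all the marked occurrences. For
fixed σ the two standardized blocks range independently over all permutations; for fixed (α, β) the
product ranges over all permutations of length k + j. -/
theorem markedNumber_joinMarks {m k j : ℕ} (τ : Equiv.Perm (Fin m)) (S T : Finset ℕ)
    (hS : ∀ s ∈ S, s + m ≤ k) (hT : ∀ s ∈ T, s + m ≤ j) :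
    (k + j).factorial * (markedNumber τ k S * markedNumber τ j T) =
      (k.factorial * j.factorial) * markedNumber τ (k + j) (joinMarks k S T) := by
  classical
  have hsum : ∑ σ : Equiv.Perm (Fin (k + j)), ∑ x : Equiv.Perm (Fin k) × Equiv.Perm (Fin j),
      (if ∀ s ∈ joinMarks k S T, OccursAt τ (σ * blockPerm x.1 x.2) s then 1 else 0) =
      ∑ x : Equiv.Perm (Fin k) × Equiv.Perm (Fin j), ∑ σ : Equiv.Perm (Fin (k + j)),
      (if ∀ s ∈ joinMarks k S T, OccursAt τ (σ * blockPerm x.1 x.2) s then 1 else 0) :=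
    Finset.sum_comm
  have hl : ∀ σ : Equiv.Perm (Fin (k + j)), ∑ x : Equiv.Perm (Fin k) × Equiv.Perm (Fin j),
      (if ∀ s ∈ joinMarks k S T, OccursAt τ (σ * blockPerm x.1 x.2) s then 1 else 0) =
      markedNumber τ k S * markedNumber τ j T := by
    intro σ
    obtain ⟨ρ₁, ρ₂, h⟩ := exists_forall_occursAt_mul_blockPerm τ S T hS hT σ
    simp_rw [h]
    rw [Fintype.sum_prod_type, markedNumber, markedNumber, Finset.card_filter, Finset.card_filter,
      ← Equiv.sum_comp (Equiv.mulLeft ρ₁) fun α => if ∀ s ∈ S, OccursAt τ α s then 1 else 0,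
      ← Equiv.sum_comp (Equiv.mulLeft ρ₂) fun β => if ∀ s ∈ T, OccursAt τ β s then 1 else 0,
      Finset.sum_mul_sum]
    refine Finset.sum_congr rfl fun α _ => Finset.sum_congr rfl fun β _ => ?_
    have hand : ∀ (p q : Prop) [Decidable (p ∧ q)] [Decidable p] [Decidable q],
        (if p ∧ q then 1 else 0) = (if p then 1 else 0) * if q then 1 else 0 := by
      intro p q _ _ _
      by_cases p <;> by_cases q <;> simp [*]
    exact hand _ _
  have hr : ∀ x : Equiv.Perm (Fin k) × Equiv.Perm (Fin j), ∑ σ : Equiv.Perm (Fin (k + j)),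
      (if ∀ s ∈ joinMarks k S T, OccursAt τ (σ * blockPerm x.1 x.2) s then 1 else 0) =
      markedNumber τ (k + j) (joinMarks k S T) := by
    intro x
    rw [markedNumber, Finset.card_filter]
    exact Equiv.sum_comp (Equiv.mulRight (blockPerm x.1 x.2))
      fun σ => if ∀ s ∈ joinMarks k S T, OccursAt τ σ s then 1 else 0
  simp_rw [hl, hr] at hsum
  simpa [Fintype.card_perm] using hsum

/-! ### Cuts of a set of marks -/

/-- No marked block of length `m` straddles the gap in front of position `k`. -/
def IsCut (m : ℕ) (S : Finset ℕ) (k : ℕ) : Prop := ∀ s ∈ S, s < k → s + m ≤ k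

/-- `k` is the first cut after the beginning of the word. -/
def IsFirstCut (m : ℕ) (S : Finset ℕ) (k : ℕ) : Prop :=
  0 < k ∧ IsCut m S k ∧ ∀ c, 0 < c → c < k → ¬ IsCut m S c

/-- The first cut after the beginning of the word. -/
noncomputable def firstCut (m : ℕ) (S : Finset ℕ) : ℕ := sInf {k | 0 < k ∧ IsCut m S k}

theorem isFirstCut_firstCut {m k : ℕ} {S : Finset ℕ} (hk : 0 < k) (h : IsCut m S k) :
    IsFirstCut m S (firstCut m S) ∧ firstCut m S ≤ k := by
  have hmem : firstCut m S ∈ {k | 0 < k ∧ IsCut m S k} := Nat.sInf_mem ⟨k, hk, h⟩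
  exact ⟨⟨hmem.1, hmem.2, fun c hc hlt hcut => Nat.notMem_of_lt_sInf hlt ⟨hc, hcut⟩⟩,
    Nat.sInf_le ⟨hk, h⟩⟩

theorem IsFirstCut.unique {m k k' : ℕ} {S : Finset ℕ} (h : IsFirstCut m S k)
    (h' : IsFirstCut m S k') : k = k' := by
  rcases lt_trichotomy k k' with hlt | heq | hlt
  · exact absurd h.2.1 (h'.2.2 k h.1 hlt)
  · exact heq
  · exact absurd h'.2.1 (h.2.2 k' h'.1 hlt)

theorem mem_powerset_range_iff {m n : ℕ} {S : Finset ℕ} :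
    S ∈ (range (n + 1 - m)).powerset ↔ ∀ s ∈ S, s + m ≤ n := by
  rw [Finset.mem_powerset]
  constructor
  · intro h s hs
    have := Finset.mem_range.1 (h hs)
    omega
  · intro h s hs
    have := h s hs
    rw [Finset.mem_range]
    omega

theorem isCut_joinMarks {m k c : ℕ} {S T : Finset ℕ} (hc : c ≤ k) :
    IsCut m (joinMarks k S T) c ↔ IsCut m S c := by
  constructor
  · exact fun h s hs => h s (mem_joinMarks.2 (Or.inl hs))
  · intro h s hs hlt
    rcases mem_joinMarks.1 hs with hs | ⟨b, _, rfl⟩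
    · exact h s hs hlt
    · omega

theorem isFirstCut_joinMarks {m k : ℕ} {S T : Finset ℕ} :
    IsFirstCut m (joinMarks k S T) k ↔ IsFirstCut m S k := by
  refine and_congr_right fun _ => and_congr (isCut_joinMarks le_rfl) ?_
  refine forall_congr' fun c => forall_congr' fun _ => forall_congr' fun hc => ?_
  rw [isCut_joinMarks hc.le]

/-- As m > 0, marks of the first block lie below k and the shifted marks of the second do not. -/
theorem joinMarks_injective {m k : ℕ} (hm : 0 < m) {S S' T T' : Finset ℕ}
    (hS : ∀ s ∈ S, s + m ≤ k) (hS' : ∀ s ∈ S', s + m ≤ k)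
    (h : joinMarks k S T = joinMarks k S' T') : S = S' ∧ T = T' := by
  have h' : ∀ a, (a ∈ S ∨ ∃ b ∈ T, k + b = a) ↔ (a ∈ S' ∨ ∃ b ∈ T', k + b = a) := fun a => by
    rw [← mem_joinMarks, ← mem_joinMarks, h]
  constructor
  · ext a
    constructor
    · intro ha
      rcases (h' a).1 (Or.inl ha) with h1 | ⟨b, _, hb⟩
      · exact h1
      · have := hS a ha
        omega
    · intro ha
      rcases (h' a).2 (Or.inl ha) with h1 | ⟨b, _, hb⟩
      · exact h1
      · have := hS' a ha
        omega
  · ext a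
    constructor
    · intro ha
      rcases (h' (k + a)).1 (Or.inr ⟨a, ha, rfl⟩) with h1 | ⟨b, hb, e⟩
      · have := hS' _ h1
        omega
      · rwa [← Nat.add_left_cancel e]
    · intro ha
      rcases (h' (k + a)).2 (Or.inr ⟨a, ha, rfl⟩) with h1 | ⟨b, hb, e⟩
      · have := hS _ h1
        omega
      · rwa [← Nat.add_left_cancel e]

theorem exists_joinMarks_eq {m n k : ℕ} {U : Finset ℕ} (hU : ∀ s ∈ U, s + m ≤ n)
    (hk : IsCut m U k) :
    ∃ S T, joinMarks k S T = U ∧ (∀ s ∈ S, s + m ≤ k) ∧ ∀ s ∈ T, s + m ≤ n - k := by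
  refine ⟨{s ∈ U | s < k}, ({s ∈ U | k ≤ s}).image (· - k), ?_, ?_, ?_⟩
  · ext a
    rw [mem_joinMarks]
    simp only [Finset.mem_filter, Finset.mem_image, exists_exists_and_eq_and]
    constructor
    · rintro (h | ⟨b, ⟨hb, hkb⟩, rfl⟩)
      · exact h.1
      · rwa [Nat.add_sub_cancel' hkb]
    · intro h
      rcases lt_or_ge a k with hlt | hge
      · exact Or.inl ⟨h, hlt⟩
      · exact Or.inr ⟨a, ⟨h, hge⟩, by omega⟩
  · intro s hs
    rw [Finset.mem_filter] at hs
    exact hk s hs.1 hs.2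
  · intro s hs
    simp only [Finset.mem_filter, Finset.mem_image] at hs
    obtain ⟨b, ⟨hb, hkb⟩, rfl⟩ := hs
    have := hU b hb
    omega

/-! ### Weights and splitting at the first cut -/

/-- The contribution of the position set `S` to the generating function of marked permutations. -/
noncomputable def markWeight {m : ℕ} (τ : Equiv.Perm (Fin m)) (n : ℕ) (S : Finset ℕ) :
    Polynomial ℚ :=
  Polynomial.C ((markedNumber τ n S : ℚ) / (n.factorial : ℚ)) * (Polynomial.X - 1) ^ #S

theorem markWeight_joinMarks {m k j : ℕ} (hm : 0 < m) (τ : Equiv.Perm (Fin m)) (S T : Finset ℕ)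
    (hS : ∀ s ∈ S, s + m ≤ k) (hT : ∀ s ∈ T, s + m ≤ j) :
    markWeight τ (k + j) (joinMarks k S T) = markWeight τ k S * markWeight τ j T := by
  have hcard : #(joinMarks k S T) = #S + #T := by
    rw [joinMarks, Finset.card_union_of_disjoint, Finset.card_map]
    rw [Finset.disjoint_left]
    intro s hs hs'
    obtain ⟨b, -, hb⟩ := Finset.mem_map.1 hs'
    have := hS s hs
    simp only [addLeftEmbedding_apply] at hb
    omega
  have hnum : (markedNumber τ (k + j) (joinMarks k S T) : ℚ) / ((k + j).factorial : ℚ) =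
      (markedNumber τ k S : ℚ) / (k.factorial : ℚ) *
        ((markedNumber τ j T : ℚ) / (j.factorial : ℚ)) := by
    have h := congrArg (Nat.cast : ℕ → ℚ) (markedNumber_joinMarks τ S T hS hT)
    push_cast at h
    have h1 : ((k + j).factorial : ℚ) ≠ 0 := by exact_mod_cast Nat.factorial_ne_zero _
    have h2 : (k.factorial : ℚ) ≠ 0 := by exact_mod_cast Nat.factorial_ne_zero _
    have h3 : (j.factorial : ℚ) ≠ 0 := by exact_mod_cast Nat.factorial_ne_zero _
    field_simp
    linarith
  rw [markWeight, markWeight, markWeight, hcard, hnum, pow_add, Polynomial.C_mul]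
  ring

/-- The coefficient of `x ^ n` in the generating function of marked permutations. -/
noncomputable def markedCoeff {m : ℕ} (τ : Equiv.Perm (Fin m)) (n : ℕ) : Polynomial ℚ :=
  ∑ S ∈ (range (n + 1 - m)).powerset, markWeight τ n S

open Classical in
/-- The coefficient of `x ^ n` in the generating function of those marked permutations that cannot
be cut. -/
noncomputable def uncutCoeff {m : ℕ} (τ : Equiv.Perm (Fin m)) (n : ℕ) : Polynomial ℚ :=
  ∑ S ∈ (range (n + 1 - m)).powerset with IsFirstCut m S n, markWeight τ n S

/-- The end n > 0 is itself a cut, so a first cut k ≤ n exists. The mark sets with first cut k are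
exactly the joins of a set on k places without inner cut and an arbitrary set on n - k places. -/
theorem markedCoeff_eq_sum {m : ℕ} (hm : 0 < m) (τ : Equiv.Perm (Fin m)) {n : ℕ} (hn : 0 < n) :
    markedCoeff τ n = ∑ x ∈ antidiagonal n, uncutCoeff τ x.1 * markedCoeff τ x.2 := by
  classical
  have hcut : ∀ S ∈ (range (n + 1 - m)).powerset, IsCut m S n := fun S hS s hs _ =>
    mem_powerset_range_iff.1 hS s hs
  rw [markedCoeff, ← Finset.sum_fiberwise_of_maps_to (s := (range (n + 1 - m)).powerset)
    (t := antidiagonal n) (g := fun S => (firstCut m S, n - firstCut m S))]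
  · refine Finset.sum_congr rfl ?_
    rintro ⟨k, j⟩ hx
    rw [HasAntidiagonal.mem_antidiagonal] at hx
    simp only at hx
    subst hx
    rw [uncutCoeff, markedCoeff, Finset.sum_mul_sum, ← Finset.sum_product']
    symm
    refine Finset.sum_nbij (fun x => joinMarks k x.1 x.2) ?_ ?_ ?_ ?_
    · rintro ⟨S, T⟩ hST
      rw [Finset.mem_product, Finset.mem_filter, mem_powerset_range_iff,
        mem_powerset_range_iff] at hST
      obtain ⟨⟨hS, hk⟩, hT⟩ := hST
      have hmem : joinMarks k S T ∈ (range (k + j + 1 - m)).powerset := by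
        rw [mem_powerset_range_iff]
        intro s hs
        rcases mem_joinMarks.1 hs with hs | ⟨b, hb, rfl⟩
        · have := hS s hs
          omega
        · have := hT b hb
          simp only at this
          omega
      have := (isFirstCut_firstCut hn (hcut _ hmem)).1.unique (isFirstCut_joinMarks.2 hk)
      rw [Finset.mem_filter]
      exact ⟨hmem, by rw [this, Nat.add_sub_cancel_left]⟩
    · rintro ⟨S, T⟩ hST ⟨S', T'⟩ hST' h
      rw [Finset.mem_coe, Finset.mem_product, Finset.mem_filter, mem_powerset_range_iff]
        at hST hST'
      obtain ⟨rfl, rfl⟩ := joinMarks_injective hm hST.1.1 hST'.1.1 h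
      rfl
    · intro U hU
      rw [Finset.mem_coe, Finset.mem_filter] at hU
      obtain ⟨hU, hk⟩ := hU
      have hk' := (isFirstCut_firstCut hn (hcut _ hU)).1
      rw [(Prod.mk.inj hk).1] at hk'
      rw [mem_powerset_range_iff] at hU
      obtain ⟨S, T, rfl, hS, hT⟩ := exists_joinMarks_eq hU hk'.2.1
      rw [isFirstCut_joinMarks] at hk'
      rw [Nat.add_sub_cancel_left] at hT
      refine ⟨(S, T), ?_, rfl⟩
      rw [Finset.mem_coe, Finset.mem_product, Finset.mem_filter, mem_powerset_range_iff,
        mem_powerset_range_iff]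
      exact ⟨⟨hS, hk'⟩, hT⟩
    · rintro ⟨S, T⟩ hST
      rw [Finset.mem_product, Finset.mem_filter, mem_powerset_range_iff,
        mem_powerset_range_iff] at hST
      exact (markWeight_joinMarks hm τ S T hST.1.1 hST.2).symm
  · intro S hS
    rw [HasAntidiagonal.mem_antidiagonal]
    have := (isFirstCut_firstCut hn (hcut S hS)).2
    simp only
    omega

/-! ### Clusters are the marked permutations without inner cut -/

/-- At an earlier cut c, every marked occurrence starting below c ends by c, so the mark linked to
it also starts below c; then the last occurrence could not reach n. -/
theorem IsCluster.isFirstCut {m n l : ℕ} (hm : 0 < m) {τ : Equiv.Perm (Fin m)}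
    {σ : Equiv.Perm (Fin n)} {i : Fin l → ℕ} (h : IsCluster τ σ i) :
    IsFirstCut m (univ.image i) n := by
  obtain ⟨hl, h0, hn⟩ := h.covered
  refine ⟨by omega, fun s hs _ => ?_, fun c hc hcn hcut => ?_⟩
  · obtain ⟨k, -, rfl⟩ := Finset.mem_image.1 hs
    obtain ⟨h, -⟩ := h.occurs k
    exact h
  · have hlt : ∀ k (hk : k < l), i ⟨k, hk⟩ < c := by
      intro k
      induction k with
      | zero => intro _; omega
      | succ k ih =>
        intro hk
        have h1 := h.linked k hk
        have h2 := hcut _ (Finset.mem_image_of_mem i (Finset.mem_univ ⟨k, by omega⟩))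
          (ih (by omega))
        omega
    have := hcut _ (Finset.mem_image_of_mem i (Finset.mem_univ ⟨l - 1, by omega⟩)) (hlt _ _)
    omega

/-- Every inner gap is straddled: gap 1 forces a mark at 0, gap n - 1 an occurrence ending at n, and
the gap in front of a later mark forces the preceding occurrence to overlap it. -/
theorem isCluster_orderEmbOfFin {m n : ℕ} (hn : 2 ≤ n) {τ : Equiv.Perm (Fin m)}
    {σ : Equiv.Perm (Fin n)} {S : Finset ℕ} (hS : ∀ s ∈ S, OccursAt τ σ s)
    (hcut : IsFirstCut m S n) {l : ℕ} (hl : #S = l) : IsCluster τ σ (S.orderEmbOfFin hl) := by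
  have hmem : ∀ k, S.orderEmbOfFin hl k ∈ S := Finset.orderEmbOfFin_mem S hl
  have hex : ∀ s ∈ S, ∃ k, S.orderEmbOfFin hl k = s := fun s hs => by
    have : s ∈ Set.range (S.orderEmbOfFin hl) := by rwa [Finset.range_orderEmbOfFin]
    exact this
  have hstraddle : ∀ c, 0 < c → c < n → ∃ k, S.orderEmbOfFin hl k < c ∧
      c < S.orderEmbOfFin hl k + m := by
    intro c hc hcn
    have := hcut.2.2 c hc hcn
    simp only [IsCut, not_forall, not_le] at this
    obtain ⟨s, hs, h1, h2⟩ := this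
    obtain ⟨k, rfl⟩ := hex s hs
    exact ⟨k, h1, h2⟩
  have hle : ∀ k, S.orderEmbOfFin hl k + m ≤ n := fun k => by
    obtain ⟨h, -⟩ := hS _ (hmem k)
    exact h
  refine ⟨fun k => hS _ (hmem k), fun k h => (S.orderEmbOfFin hl).strictMono (by simp),
    fun k h => ?_, ?_⟩
  · by_contra! hlt
    have hpos : S.orderEmbOfFin hl ⟨k, by omega⟩ < S.orderEmbOfFin hl ⟨k + 1, h⟩ :=
      (S.orderEmbOfFin hl).strictMono (by simp)
    have hm : 0 < m := by
      obtain ⟨a, h1, h2⟩ := hstraddle 1 one_pos (by omega)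
      omega
    obtain ⟨a, h1, h2⟩ := hstraddle (S.orderEmbOfFin hl ⟨k + 1, h⟩) (by omega)
      (by have := hle ⟨k + 1, h⟩; omega)
    have h3 := (S.orderEmbOfFin hl).lt_iff_lt.1 h1
    have h4 : S.orderEmbOfFin hl a ≤ S.orderEmbOfFin hl ⟨k, by omega⟩ :=
      (S.orderEmbOfFin hl).monotone (by rw [Fin.lt_def] at h3; rw [Fin.le_def]; simp only at *; omega)
    omega
  · obtain ⟨a, h1, h2⟩ := hstraddle 1 one_pos (by omega)
    obtain ⟨b, h3, h4⟩ := hstraddle (n - 1) (by omega) (by omega)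
    have ha := a.2
    have h5 : S.orderEmbOfFin hl ⟨0, by omega⟩ ≤ S.orderEmbOfFin hl a :=
      (S.orderEmbOfFin hl).monotone (by rw [Fin.le_def]; simp)
    have h6 : S.orderEmbOfFin hl b ≤ S.orderEmbOfFin hl ⟨l - 1, by omega⟩ :=
      (S.orderEmbOfFin hl).monotone (by rw [Fin.le_def]; simp only; omega)
    have h7 := hle ⟨l - 1, by omega⟩
    exact ⟨by omega, by omega, by omega⟩

-- An increasing tuple of marks amounts to its set. With n ≥ 2 the empty set is excluded, having a
-- cut at 1.
open Classical in
theorem clusterNumber_eq_sum {m : ℕ} (hm : 0 < m) (τ : Equiv.Perm (Fin m)) {n : ℕ} (hn : 2 ≤ n)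
    (l : ℕ) :
    clusterNumber τ n l = ∑ S ∈ (range (n + 1 - m)).powerset with IsFirstCut m S n ∧ #S = l,
      markedNumber τ n S := by
  simp only [markedNumber]
  rw [← Finset.card_sigma, ← Set.ncard_coe_finset, clusterNumber]
  refine Set.ncard_congr (fun c _ => ⟨univ.image c.2, c.1⟩) ?_ ?_ ?_
  · rintro ⟨σ, i⟩ h
    have h : IsCluster τ σ i := h
    rw [Finset.mem_coe, Finset.mem_sigma, Finset.mem_filter, Finset.mem_filter,
      mem_powerset_range_iff]
    have hocc : ∀ s ∈ univ.image i, OccursAt τ σ s := by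
      intro s hs
      obtain ⟨k, -, rfl⟩ := Finset.mem_image.1 hs
      exact h.occurs k
    refine ⟨⟨fun s hs => ?_, h.isFirstCut hm, ?_⟩, Finset.mem_univ _, hocc⟩
    · obtain ⟨h, -⟩ := hocc s hs
      exact h
    · rw [Finset.card_image_of_injective _ h.strictMono.injective]
      simp
  · rintro ⟨σ, i⟩ ⟨σ', i'⟩ h h' e
    have h : IsCluster τ σ i := h
    have h' : IsCluster τ σ' i' := h'
    simp only [Sigma.mk.injEq, heq_eq_eq] at e
    refine Prod.ext e.2 ((h.strictMono.range_inj h'.strictMono).1 ?_)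
    have := congrArg (fun S : Finset ℕ => (S : Set ℕ)) e.1
    simpa using this
  · rintro ⟨S, σ⟩ h
    rw [Finset.mem_coe, Finset.mem_sigma, Finset.mem_filter, Finset.mem_filter] at h
    obtain ⟨⟨-, hcut, hl⟩, -, hocc⟩ := h
    refine ⟨(σ, S.orderEmbOfFin hl), isCluster_orderEmbOfFin hn hocc hcut hl, ?_⟩
    simp

theorem uncutCoeff_zero {m : ℕ} (τ : Equiv.Perm (Fin m)) : uncutCoeff τ 0 = 0 := by
  classical
  rw [uncutCoeff, Finset.filter_false_of_mem, Finset.sum_empty]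
  exact fun S _ h => lt_irrefl 0 h.1

theorem uncutCoeff_one {m : ℕ} (hm : 2 ≤ m) (τ : Equiv.Perm (Fin m)) : uncutCoeff τ 1 = 1 := by
  classical
  have : range (1 + 1 - m) = ∅ := by rw [Finset.range_eq_empty_iff]; omega
  rw [uncutCoeff, this, Finset.powerset_empty, Finset.filter_true_of_mem]
  · simp [markWeight, markedNumber]
  · intro S hS
    rw [Finset.mem_singleton] at hS
    subst hS
    exact ⟨one_pos, by simp [IsCut], by omega⟩

theorem uncutCoeff_of_two_le {m : ℕ} (hm : 0 < m) (τ : Equiv.Perm (Fin m)) {n : ℕ} (hn : 2 ≤ n) :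
    uncutCoeff τ n = ∑ l ∈ Icc 1 n,
      Polynomial.C ((clusterNumber τ n l : ℚ) / (n.factorial : ℚ)) * (Polynomial.X - 1) ^ l := by
  classical
  rw [uncutCoeff, ← Finset.sum_fiberwise_of_maps_to (t := Icc 1 n) (g := Finset.card)]
  · refine Finset.sum_congr rfl fun l _ => ?_
    rw [clusterNumber_eq_sum hm τ hn, Finset.filter_filter, Nat.cast_sum, Finset.sum_div, map_sum,
      Finset.sum_mul]
    refine Finset.sum_congr rfl fun S hS => ?_
    rw [markWeight, (Finset.mem_filter.1 hS).2.2]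
  · intro S hS
    rw [Finset.mem_filter] at hS
    obtain ⟨hS, -, -, hcut⟩ := hS
    have hle := Finset.card_le_card (Finset.mem_powerset.1 hS)
    rw [Finset.card_range] at hle
    have hne : S.Nonempty := by
      rw [Finset.nonempty_iff_ne_empty]
      rintro rfl
      exact hcut 1 one_pos (by omega) (by simp [IsCut])
    have := hne.card_pos
    rw [Finset.mem_Icc]
    omega

/-! ### Inclusion-exclusion and the cluster theorem -/

theorem sum_occurrenceNumber {m : ℕ} (hm : 0 < m) (τ : Equiv.Perm (Fin m)) (n : ℕ) :
    ∑ k ∈ range (n + 1), Polynomial.C ((occurrenceNumber τ n k : ℚ) / (n.factorial : ℚ)) *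
      Polynomial.X ^ k = markedCoeff τ n := by
  classical
  set occ : Equiv.Perm (Fin n) → Finset ℕ := fun σ => {s ∈ range (n + 1 - m) | OccursAt τ σ s}
    with hocc
  have hcard : ∀ σ : Equiv.Perm (Fin n), occurrences τ σ = #(occ σ) := by
    intro σ
    rw [occurrences, ← Set.ncard_coe_finset]
    congr 1
    ext s
    simp only [hocc, Set.mem_ofPred_eq, Finset.coe_filter, Finset.mem_range]
    refine ⟨fun h => ⟨?_, h⟩, fun h => h.2⟩
    obtain ⟨h, -⟩ := h
    omega
  have hl : ∑ k ∈ range (n + 1), Polynomial.C ((occurrenceNumber τ n k : ℚ) / (n.factorial : ℚ)) *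
      Polynomial.X ^ k =
      ∑ σ : Equiv.Perm (Fin n), Polynomial.C (1 / (n.factorial : ℚ)) * Polynomial.X ^ #(occ σ) := by
    rw [← Finset.sum_fiberwise_of_maps_to (t := range (n + 1)) (g := fun σ => #(occ σ))]
    · refine Finset.sum_congr rfl fun k _ => ?_
      have : occurrenceNumber τ n k = #{σ : Equiv.Perm (Fin n) | #(occ σ) = k} := by
        rw [occurrenceNumber, ← Set.ncard_coe_finset]
        simp [hcard]
      rw [this, Finset.sum_congr rfl fun σ hσ => by rw [(Finset.mem_filter.1 hσ).2],
        Finset.sum_const, nsmul_eq_mul, ← mul_assoc, ← Polynomial.C_eq_natCast, ← Polynomial.C_mul,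
        mul_one_div]
    · intro σ _
      have := Finset.card_le_card (Finset.filter_subset (fun s => OccursAt τ σ s)
        (range (n + 1 - m)))
      rw [Finset.card_range] at this
      rw [Finset.mem_range]
      simp only [hocc]
      omega
  have hr : markedCoeff τ n = ∑ S ∈ (range (n + 1 - m)).powerset, ∑ σ : Equiv.Perm (Fin n),
      if ∀ s ∈ S, OccursAt τ σ s then
        Polynomial.C (1 / (n.factorial : ℚ)) * (Polynomial.X - 1) ^ #S else 0 := by
    refine Finset.sum_congr rfl fun S _ => ?_
    rw [← Finset.sum_filter, Finset.sum_const, nsmul_eq_mul, ← mul_assoc,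
      ← Polynomial.C_eq_natCast, ← Polynomial.C_mul, mul_one_div, markWeight, markedNumber]
  rw [hl, hr, Finset.sum_comm]
  refine Finset.sum_congr rfl fun σ _ => ?_
  rw [← Finset.sum_filter, ← Finset.mul_sum]
  congr 1
  have hpow : {S ∈ (range (n + 1 - m)).powerset | ∀ s ∈ S, OccursAt τ σ s} = (occ σ).powerset := by
    ext S
    simp only [hocc, Finset.mem_filter, Finset.mem_powerset, Finset.subset_iff]
    exact ⟨fun h s hs => ⟨h.1 hs, h.2 s hs⟩, fun h => ⟨fun s hs => (h hs).1, fun s hs => (h hs).2⟩⟩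
  -- Expansion of ((t - 1) + 1)^#occ over the subsets of the set of occurrences.
  have := Finset.sum_pow_mul_eq_add_pow (Polynomial.X - 1 : Polynomial ℚ) 1 (occ σ)
  rw [hpow]
  simpa using this.symm

/-- The cluster theorem of Goulden and Jackson for consecutive occurrences of a pattern. -/
theorem occurrenceSeries_mul_eq_one {m : ℕ} (hm : 2 ≤ m) (τ : Equiv.Perm (Fin m)) :
    occurrenceSeries τ * (1 - PowerSeries.X - clusterSeries τ) = 1 := by
  have hocc : occurrenceSeries τ = PowerSeries.mk (markedCoeff τ) := by
    ext1 n
    rw [occurrenceSeries, PowerSeries.coeff_mk, PowerSeries.coeff_mk,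
      sum_occurrenceNumber (by omega)]
  have huncut : PowerSeries.X + clusterSeries τ = PowerSeries.mk (uncutCoeff τ) := by
    ext1 n
    rw [map_add, clusterSeries, PowerSeries.coeff_mk, PowerSeries.coeff_mk, PowerSeries.coeff_X]
    rcases n with _ | _ | n
    · simp [uncutCoeff_zero]
    · simp [uncutCoeff_one hm]
    · rw [uncutCoeff_of_two_le (by omega) τ (by omega)]
      simp
  have hzero : markedCoeff τ 0 = 1 := by
    have : range (0 + 1 - m) = ∅ := by rw [Finset.range_eq_empty_iff]; omega
    rw [markedCoeff, this]
    simp [markWeight, markedNumber]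
  have hrec : PowerSeries.mk (markedCoeff τ) =
      1 + PowerSeries.mk (uncutCoeff τ) * PowerSeries.mk (markedCoeff τ) := by
    ext1 n
    rw [map_add, PowerSeries.coeff_mul, PowerSeries.coeff_one]
    simp only [PowerSeries.coeff_mk]
    rcases Nat.eq_zero_or_pos n with rfl | hn
    · simp [hzero, uncutCoeff_zero]
    · rw [if_neg hn.ne', zero_add]
      exact markedCoeff_eq_sum (by omega) τ hn
  rw [sub_sub, huncut, hocc]
  linear_combination hrec

end ConsecutivePattern

theorem mainTheorem7 :
    -- the cluster numbers are sums of the refined ones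
    (∀ n l : ℕ,
      ConsecutivePattern.clusterNumber ConsecutivePattern.pattern2413 n l =
        ∑ p ∈ Finset.Icc 2 n, ∑ q ∈ Finset.Icc (p + 2) n,
          ConsecutivePattern.refinedClusterNumber ConsecutivePattern.pattern2413 n l p q) ∧
    -- the recurrence
    (∀ n l p q : ℕ, 5 ≤ n → 1 ≤ l → 1 ≤ p → p ≤ n → 1 ≤ q → q ≤ n →
      ConsecutivePattern.refinedClusterNumber ConsecutivePattern.pattern2413 n l p q =
        (∑ r ∈ Finset.Ico 1 p, ∑ s ∈ Finset.Ioo p q,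
          ConsecutivePattern.refinedClusterNumber ConsecutivePattern.pattern2413
            (n - 2) (l - 1) r (s - 1)) +
        (∑ r ∈ Finset.Ioo p q, ∑ s ∈ Finset.Ioo r q,
          (p - 1) * ConsecutivePattern.refinedClusterNumber ConsecutivePattern.pattern2413
            (n - 3) (l - 1) (r - 2) (s - 2)) +
        (∑ r ∈ Finset.Ioo p q, ∑ s ∈ Finset.Ioc q n,
          (p - 1) * ConsecutivePattern.refinedClusterNumber ConsecutivePattern.pattern2413
            (n - 3) (l - 1) (r - 2) (s - 3))) ∧
    -- the initial conditions
    (∀ n p q : ℕ,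
      ConsecutivePattern.refinedClusterNumber ConsecutivePattern.pattern2413 n 0 p q = 0) ∧
    (∀ l p q : ℕ,
      ConsecutivePattern.refinedClusterNumber ConsecutivePattern.pattern2413 2 l p q = 0) ∧
    (∀ l p q : ℕ,
      ConsecutivePattern.refinedClusterNumber ConsecutivePattern.pattern2413 3 l p q = 0) ∧
    (∀ l p q : ℕ,
      ConsecutivePattern.refinedClusterNumber ConsecutivePattern.pattern2413 4 l p q =
        if l = 1 ∧ p = 2 ∧ q = 4 then 1 else 0) ∧
    -- the generating function for occurrences is the inverse of `1 - x - ∑ …`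
    ConsecutivePattern.occurrenceSeries ConsecutivePattern.pattern2413 *
      (1 - PowerSeries.X - ConsecutivePattern.clusterSeries ConsecutivePattern.pattern2413) = 1 := by
  exact ⟨ConsecutivePattern.clusterNumber_pattern2413,
    fun _ _ _ _ hn hl hp _ _ hq =>
      ConsecutivePattern.refinedClusterNumber_recurrence hn hl hp hq,
    ConsecutivePattern.refinedClusterNumber_zero_right _,
    ConsecutivePattern.refinedClusterNumber_eq_zero_of_lt _ (by decide),
    ConsecutivePattern.refinedClusterNumber_eq_zero_of_lt _ (by decide),
    ConsecutivePattern.refinedClusterNumber_four,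
    ConsecutivePattern.occurrenceSeries_mul_eq_one (by decide) _⟩
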